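/- Consider rational data $c\in\mathbb Q^{n_x}$, $d,f\in\mathbb Q^{n_y}$, $G\in\mathbb Q^{k\times n_x}$, $g\in\mathbb Q^{k}$, $C\in\mathbb Q^{l\times n_x}$, $D\in\mathbb Q^{l\times n_y}$, $b\in\mathbb Q^{l}$, and let $X=\{x\in\mathbb R^{n_x}: Gx\ge g\}$. For $x\in X$ let $S(x)$ be the set of optimal solutions of $\min_y\{f^\top y: Cx+Dy\ge b\}$. Assume that (i) for every $x\in X$ the set $\{y\in\mathbb R^{n_y}: Cx+Dy\ge b\}$ is non-empty and compact, (ii) $X$ is non-empty, and (iii) the function $x\mapsto c^\top x+\min_y\{d^\top y: y\in S(x)\}$ is bounded from below on $X$. Let $\tilde X=\{(x,\bar y): x\in X,\ D\bar y\ge b-Cx\}$ and, for $(x,\bar y)\in\tilde X$, let $\tilde S(x,\bar y)$ be the set of optimal solutions $(y,\varepsilon)\in\mathbb R^{n_y}\times\mathbb R$ of $$\min_{y,\varepsilon}\ f^\top y\quad\text{s.t.}\quad Cx+Dy\ge b,\quad f^\top\bar y-f^\top y=\varepsilon,\quad \varepsilon\ge 0 .$$ Then there is a rational $\kappa>0$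 of polynomial size (that is, the bit-encoding length of $\kappa$ is bounded by a fixed polynomial, independent of the instance, in the bit-encoding length of the data $c,d,f,G,g,C,D,b$) such that the optimistic bilevel problem with the single coupling constraint $\varepsilon=0$, $$\min_{(x,\bar y)\in\tilde X}\ c^\top x+d^\top\bar y+\min_{y,\varepsilon}\{0:\ \varepsilon=0,\ (y,\varepsilon)\in\tilde S(x,\bar y)\},$$ and the optimistic bilevel problem without coupling constraints $$\min_{(x,\bar y)\in\tilde X}\ c^\top x+d^\top\bar y+\min_{y,\varepsilon}\{\kappa\varepsilon:\ (y,\varepsilon)\in\tilde S(x,\bar y)\}$$ have the same set of globally optimal solutions $(x,\bar y)$. Here a minimum over the empty set is $+\infty$. -/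

import Mathlib

open Matrix

/-- Bit length of a rational `p / q` in lowest terms: a sign bit plus the binary lengths of
`|p|` and `q`. -/
def ratSize (r : ℚ) : ℕ := 1 + Nat.size r.num.natAbs + Nat.size r.den

/-- Bit length of a rational vector: its dimension plus the bit lengths of its entries. -/
def vecSize {n : ℕ} (v : Fin n → ℚ) : ℕ := n + ∑ i, ratSize (v i)

/-- Bit length of a rational matrix: the number of entries plus their bit lengths. -/
def matSize {m n : ℕ} (A : Matrix (Fin m) (Fin n) ℚ) : ℕ := m * n + ∑ i, ∑ j, ratSize (A i j)

/-- A rational vector, read as a real vector. -/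
def realVec {n : ℕ} (v : Fin n → ℚ) : Fin n → ℝ := fun i => (v i : ℝ)

/-- A rational matrix, read as a real matrix. -/
def realMat {m n : ℕ} (A : Matrix (Fin m) (Fin n) ℚ) : Matrix (Fin m) (Fin n) ℝ :=
  A.map (fun q : ℚ => (q : ℝ))

/-- The rational data of a linear bilevel problem with `nx` leader variables, `ny` follower
variables, `k` leader constraints `G x ≥ g` and `l` follower constraints `C x + D y ≥ b`. -/
structure BilevelData (nx ny k l : ℕ) where
  c : Fin nx → ℚ
  d : Fin ny → ℚ
  f : Fin ny → ℚ
  G : Matrix (Fin k) (Fin nx) ℚ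
  g : Fin k → ℚ
  C : Matrix (Fin l) (Fin nx) ℚ
  D : Matrix (Fin l) (Fin ny) ℚ
  b : Fin l → ℚ

namespace BilevelData

variable {nx ny k l : ℕ}

/-- The bit-encoding length of the data. -/
def encodingLength (P : BilevelData nx ny k l) : ℕ :=
  vecSize P.c + vecSize P.d + vecSize P.f + matSize P.G + vecSize P.g +
    matSize P.C + matSize P.D + vecSize P.b

/-- The polyhedron `X = {x | G x ≥ g}` of the leader. -/
def leaderSet (P : BilevelData nx ny k l) : Set (Fin nx → ℝ) :=
  {x | realVec P.g ≤ realMat P.G *ᵥ x}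

/-- The follower's feasible set `{y | C x + D y ≥ b}`. -/
def followerFeasible (P : BilevelData nx ny k l) (x : Fin nx → ℝ) : Set (Fin ny → ℝ) :=
  {y | realVec P.b ≤ realMat P.C *ᵥ x + realMat P.D *ᵥ y}

/-- `S(x)`: the minimizers of `fᵀ y` over the follower's feasible set. -/
def followerOpt (P : BilevelData nx ny k l) (x : Fin nx → ℝ) : Set (Fin ny → ℝ) :=
  {y | y ∈ P.followerFeasible x ∧
    IsMinOn (fun y' : Fin ny → ℝ => realVec P.f ⬝ᵥ y') (P.followerFeasible x) y}

/-- `F_o(x) = cᵀ x + min {dᵀ y | y ∈ S(x)}`, with value `+∞` if `S(x)` is empty. -/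
noncomputable def optimisticObj (P : BilevelData nx ny k l) (x : Fin nx → ℝ) : EReal :=
  ((realVec P.c ⬝ᵥ x : ℝ) : EReal) +
    ⨅ y ∈ P.followerOpt x, ((realVec P.d ⬝ᵥ y : ℝ) : EReal)

/-- The standing assumptions: `X` is non-empty, the follower's feasible set is non-empty and
compact for every `x ∈ X`, and the leader's objective function is bounded from below on `X`. -/
structure StandingAssumptions (P : BilevelData nx ny k l) : Prop where
  leaderSet_nonempty : P.leaderSet.Nonempty
  follower_nonempty : ∀ x ∈ P.leaderSet, (P.followerFeasible x).Nonempty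
  follower_compact : ∀ x ∈ P.leaderSet, IsCompact (P.followerFeasible x)
  obj_bddBelow : ∃ M : ℝ, ∀ x ∈ P.leaderSet, (M : EReal) ≤ P.optimisticObj x

/-- `X̃ = {(x, ȳ) | x ∈ X, D ȳ ≥ b - C x}`. -/
def auxLeaderSet (P : BilevelData nx ny k l) : Set ((Fin nx → ℝ) × (Fin ny → ℝ)) :=
  {p | p.1 ∈ P.leaderSet ∧ realVec P.b - realMat P.C *ᵥ p.1 ≤ realMat P.D *ᵥ p.2}

/-- Pairs `(y, ε)` with `C x + D y ≥ b`, `fᵀ ȳ - fᵀ y = ε` and `ε ≥ 0`, where `p = (x, ȳ)`. -/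
def auxFollowerFeasible (P : BilevelData nx ny k l) (p : (Fin nx → ℝ) × (Fin ny → ℝ)) :
    Set ((Fin ny → ℝ) × ℝ) :=
  {z | realVec P.b ≤ realMat P.C *ᵥ p.1 + realMat P.D *ᵥ z.1 ∧
    realVec P.f ⬝ᵥ p.2 - realVec P.f ⬝ᵥ z.1 = z.2 ∧ 0 ≤ z.2}

/-- `S̃(x, ȳ)`: the pairs `(y, ε)` that minimize `fᵀ y` over the set above. -/
def auxFollowerOpt (P : BilevelData nx ny k l) (p : (Fin nx → ℝ) × (Fin ny → ℝ)) :
    Set ((Fin ny → ℝ) × ℝ) :=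
  {z | z ∈ P.auxFollowerFeasible p ∧
    IsMinOn (fun z' : (Fin ny → ℝ) × ℝ => realVec P.f ⬝ᵥ z'.1) (P.auxFollowerFeasible p) z}

/-- `F_oa(x, ȳ) = cᵀ x + dᵀ ȳ + min {0 | ε = 0, (y, ε) ∈ S̃(x, ȳ)}`; it is `+∞` if no such
`(y, ε)` exists. -/
noncomputable def coupledObj (P : BilevelData nx ny k l)
    (p : (Fin nx → ℝ) × (Fin ny → ℝ)) : EReal :=
  ((realVec P.c ⬝ᵥ p.1 + realVec P.d ⬝ᵥ p.2 : ℝ) : EReal) +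
    ⨅ z ∈ {z : (Fin ny → ℝ) × ℝ | z.2 = 0 ∧ z ∈ P.auxFollowerOpt p}, (0 : EReal)

/-- `F_oκ(x, ȳ) = cᵀ x + dᵀ ȳ + min {κ ε | (y, ε) ∈ S̃(x, ȳ)}`. -/
noncomputable def penalizedObj (P : BilevelData nx ny k l) (κ : ℝ)
    (p : (Fin nx → ℝ) × (Fin ny → ℝ)) : EReal :=
  ((realVec P.c ⬝ᵥ p.1 + realVec P.d ⬝ᵥ p.2 : ℝ) : EReal) +
    ⨅ z ∈ P.auxFollowerOpt p, ((κ * z.2 : ℝ) : EReal)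

end BilevelData

/-- The globally optimal solutions of `min_{p ∈ K} F p`: points of `K` with `F p < +∞` at which
`F` attains its minimum over `K`. -/
def globalOptimizers {α : Type*} (K : Set α) (F : α → EReal) : Set α :=
  {p | p ∈ K ∧ F p < ⊤ ∧ IsMinOn F K p}

/-! For fixed x, the set S(x) is a polyhedron: the follower's constraints plus one row saying that
fᵀy does not exceed the optimal value. At a minimizer y of dᵀy over S(x), Farkas and Carathéodory
write d as a nonnegative combination of linearly independent active rows. Since x enters only the
right-hand sides, Cramer's rule bounds these multipliers by K = 2^(6L²), with L the encoding length,
uniformly in x.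

A feasible ȳ violates only the optimality row, by exactly its gap fᵀȳ - fᵀy. So moving from ȳ to y
raises dᵀ by at most K times the gap (`exists_mem_followerOpt_dotProduct_le`). The penalized problem
charges at least κ times the gap (`le_penalizedObj`). With κ = 2K, a non-optimal ȳ is strictly
beaten by the bilevel feasible point (x, y); where the gap vanishes, the two objectives agree. -/

/-! ### Conic duality and basic multipliers -/

/-- **Farkas' lemma**: a linear functional that is nonnegative wherever finitely many functionals
are nonnegative is a nonnegative combination of them. -/
theorem farkas_dual {ι V : Type*} [AddCommGroup V] [Module ℝ V] (s : Finset ι)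
    (φ : ι → Module.Dual ℝ V) (ψ : Module.Dual ℝ V)
    (h : ∀ v, (∀ i ∈ s, 0 ≤ φ i v) → 0 ≤ ψ v) :
    ∃ μ : ι → ℝ, (∀ i ∈ s, 0 ≤ μ i) ∧ ψ = ∑ i ∈ s, μ i • φ i := by
  classical
  induction s using Finset.induction_on generalizing φ ψ with
  | empty =>
    refine ⟨0, by simp, ?_⟩
    ext v
    have h₁ := h v (by simp)
    have h₂ := h (-v) (by simp)
    rw [map_neg] at h₂
    simp only [Finset.sum_empty, LinearMap.zero_apply]
    linarith
  | insert a s ha ih =>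
    by_cases hs : ∀ v, (∀ i ∈ s, 0 ≤ φ i v) → 0 ≤ ψ v
    · obtain ⟨μ, hμ, hψ⟩ := ih φ ψ hs
      refine ⟨fun i => if i = a then 0 else μ i, ?_, ?_⟩
      · intro i hi
        dsimp only
        split_ifs with hia
        · exact le_rfl
        · exact hμ i ((Finset.mem_insert.1 hi).resolve_left hia)
      · rw [Finset.sum_insert ha, hψ]
        simp only [if_true, zero_smul, zero_add]
        exact Finset.sum_congr rfl fun i hi => by
          rw [if_neg (ne_of_mem_of_not_mem hi ha)]
    push Not at hs
    obtain ⟨v₀, hv₀, hψ₀⟩ := hs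
    have ha₀ : φ a v₀ < 0 := by
      by_contra! hc
      refine hψ₀.not_ge (h v₀ fun i hi => ?_)
      rcases Finset.mem_insert.1 hi with rfl | hi
      exacts [hc, hv₀ i hi]
    have ha₁ := ha₀.ne
    -- Projection onto the kernel of `φ a` along `v₀`: constraint `a` becomes trivial, so the
    -- induction hypothesis applies to the other functionals composed with it.
    let T : V →ₗ[ℝ] V := LinearMap.id - (φ a).smulRight ((φ a v₀)⁻¹ • v₀)
    have hT : ∀ (χ : Module.Dual ℝ V) v, χ (T v) = χ v - φ a v * ((φ a v₀)⁻¹ * χ v₀) := by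
      intro χ v
      simp [T]
    obtain ⟨μ, hμ, hψ⟩ := ih (fun i => φ i ∘ₗ T) (ψ ∘ₗ T) (by
      intro v hv
      refine h (T v) fun i hi => ?_
      rcases Finset.mem_insert.1 hi with rfl | hi
      · rw [hT, inv_mul_cancel₀ ha₁]; simp
      · exact hv i hi)
    refine ⟨fun i => if i = a then (φ a v₀)⁻¹ * (ψ v₀ - ∑ i ∈ s, μ i * φ i v₀) else μ i, ?_, ?_⟩
    · intro i hi
      dsimp only
      split_ifs with hia
      · refine mul_nonneg_of_nonpos_of_nonpos (inv_nonpos.2 ha₀.le) ?_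
        have := Finset.sum_nonneg fun i hi => mul_nonneg (hμ i hi) (hv₀ i hi)
        linarith
      · exact hμ i ((Finset.mem_insert.1 hi).resolve_left hia)
    · ext v
      have hv := LinearMap.congr_fun hψ v
      simp only [LinearMap.comp_apply, LinearMap.sum_apply, LinearMap.smul_apply, hT,
        smul_eq_mul, mul_sub, Finset.sum_sub_distrib] at hv
      have h₁ : ∑ i ∈ s, μ i * (φ a v * ((φ a v₀)⁻¹ * φ i v₀)) =
          φ a v * (φ a v₀)⁻¹ * ∑ i ∈ s, μ i * φ i v₀ := by
        rw [Finset.mul_sum]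
        exact Finset.sum_congr rfl fun i _ => by ring
      rw [h₁] at hv
      have h₂ : ∑ i ∈ s, (if i = a then (φ a v₀)⁻¹ * (ψ v₀ - ∑ i ∈ s, μ i * φ i v₀) else μ i) *
          φ i v = ∑ i ∈ s, μ i * φ i v :=
        Finset.sum_congr rfl fun i hi => by rw [if_neg (ne_of_mem_of_not_mem hi ha)]
      rw [Finset.sum_insert ha]
      simp only [LinearMap.add_apply, LinearMap.sum_apply, LinearMap.smul_apply, smul_eq_mul]
      rw [h₂, if_pos trivial]
      linarith

/-- **Carathéodory's theorem for cones**: a nonnegative combination of finitely many vectors is a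
nonnegative combination of a linearly independent subfamily. -/
theorem exists_linearIndepOn_conic_combination {ι E : Type*} [AddCommGroup E] [Module ℝ E]
    (a : ι → E) (s : Finset ι) (μ : ι → ℝ) (hμ : ∀ i ∈ s, 0 ≤ μ i) :
    ∃ t ⊆ s, ∃ ν : ι → ℝ, (∀ i ∈ t, 0 ≤ ν i) ∧
      ∑ i ∈ t, ν i • a i = ∑ i ∈ s, μ i • a i ∧ LinearIndepOn ℝ a (t : Set ι) := by
  classical
  induction s using Finset.strongInduction generalizing μ with
  | H s ih =>
    by_cases hs : LinearIndepOn ℝ a (s : Set ι)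
    · exact ⟨s, subset_rfl, μ, hμ, rfl, hs⟩
    obtain ⟨g, hg, i₁, hi₁, hgi₁⟩ : ∃ g : ι → ℝ, ∑ i ∈ s, g i • a i = 0 ∧ ∃ i ∈ s, 0 < g i := by
      rw [linearIndepOn_finset_iff] at hs
      push Not at hs
      obtain ⟨g, hg, i, hi, hgi⟩ := hs
      rcases hgi.lt_or_gt with hneg | hpos
      · exact ⟨-g, by simp [hg], i, hi, by simpa using hneg⟩
      · exact ⟨g, hg, i, hi, hpos⟩
    -- Ratio test: subtracting the largest multiple of the relation `g` that keeps all coefficients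
    -- nonnegative kills the one at `i₀`.
    obtain ⟨i₀, hi₀, hmin⟩ := (s.filter fun i => 0 < g i).exists_min_image (fun i => μ i / g i)
      ⟨i₁, Finset.mem_filter.2 ⟨hi₁, hgi₁⟩⟩
    obtain ⟨hi₀s, hg₀⟩ := Finset.mem_filter.1 hi₀
    have hq : 0 ≤ μ i₀ / g i₀ := div_nonneg (hμ _ hi₀s) hg₀.le
    obtain ⟨t, hts, ν, hν, hsum, hli⟩ := ih (s.erase i₀) (Finset.erase_ssubset hi₀s)
      (fun i => μ i - μ i₀ / g i₀ * g i) (by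
        intro i hi
        have his := Finset.mem_of_mem_erase hi
        rw [sub_nonneg]
        rcases lt_or_ge 0 (g i) with hgi | hgi
        · rw [← le_div_iff₀ hgi]
          exact hmin i (Finset.mem_filter.2 ⟨his, hgi⟩)
        · exact (mul_nonpos_of_nonneg_of_nonpos hq hgi).trans (hμ i his))
    refine ⟨t, hts.trans (Finset.erase_subset _ _), ν, hν, ?_, hli⟩
    rw [hsum, Finset.sum_erase s (by rw [div_mul_cancel₀ _ hg₀.ne', sub_self, zero_smul])]
    simp only [sub_smul, mul_smul, Finset.sum_sub_distrib, ← Finset.smul_sum, hg, smul_zero,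
      sub_zero]

/-- At a minimizer of a linear function over a polyhedron, the objective is a nonnegative
combination of linearly independent active constraints. -/
theorem exists_basic_multipliers {ι : Type*} [Finite ι] {n : ℕ} (a : ι → Fin n → ℝ) (r : ι → ℝ)
    (d y : Fin n → ℝ) (hy : ∀ i, r i ≤ a i ⬝ᵥ y)
    (hmin : ∀ z, (∀ i, r i ≤ a i ⬝ᵥ z) → d ⬝ᵥ y ≤ d ⬝ᵥ z) :
    ∃ (t : Finset ι) (μ : ι → ℝ), (∀ i ∈ t, 0 ≤ μ i) ∧ (∀ i ∈ t, a i ⬝ᵥ y = r i) ∧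
      LinearIndepOn ℝ a (t : Set ι) ∧ ∑ i ∈ t, μ i • a i = d := by
  classical
  cases nonempty_fintype ι
  obtain ⟨μ, hμ, hd⟩ := farkas_dual (Finset.univ.filter fun i => a i ⬝ᵥ y = r i)
    (fun i => dotProductEquiv ℝ (Fin n) (a i)) (dotProductEquiv ℝ (Fin n) d) (by
      intro v hv
      simp only [Finset.mem_filter, Finset.mem_univ, true_and, dotProductEquiv_apply_apply] at hv ⊢
      -- A short step along `v` stays feasible: active rows do not decrease, slack rows stay
      -- satisfied by continuity.
      have hev : ∀ᶠ τ : ℝ in nhdsWithin 0 (Set.Ioi 0), ∀ i, r i ≤ a i ⬝ᵥ (y + τ • v) := by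
        rw [Filter.eventually_all]
        intro i
        rcases (hy i).eq_or_lt with hi | hi
        · filter_upwards [self_mem_nhdsWithin] with τ hτ
          rw [dotProduct_add, dotProduct_smul, ← hi, smul_eq_mul]
          have := mul_nonneg (le_of_lt (Set.mem_Ioi.1 hτ)) (hv i hi.symm)
          linarith
        · have hc : Continuous fun τ : ℝ => a i ⬝ᵥ (y + τ • v) := by
            simp only [dotProduct_add, dotProduct_smul]
            fun_prop
          have h0 : r i < (fun τ : ℝ => a i ⬝ᵥ (y + τ • v)) 0 := by simpa using hi
          exact Filter.Eventually.filter_mono nhdsWithin_le_nhds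
            ((hc.continuousAt.eventually (lt_mem_nhds h0)).mono fun _ h => le_of_lt h)
      obtain ⟨τ, hτ, hτ0⟩ := (hev.and self_mem_nhdsWithin).exists
      have hle := hmin _ hτ
      rw [dotProduct_add, dotProduct_smul, smul_eq_mul] at hle
      exact nonneg_of_mul_nonneg_right (by linarith) (Set.mem_Ioi.1 hτ0))
  obtain ⟨t, hts, ν, hν, hsum, hli⟩ := exists_linearIndepOn_conic_combination a _ μ hμ
  refine ⟨t, ν, hν, fun i hi => (Finset.mem_filter.1 (hts hi)).2, hli, ?_⟩
  rw [hsum]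
  apply (dotProductEquiv ℝ (Fin n)).injective
  rw [hd, map_sum]
  simp only [map_smul]

/-! ### Size bounds: Cramer's rule and clearing denominators -/

/-- A priori bound for the solution of an integral linear system with injective matrix. -/
theorem abs_le_of_integral_system {m p : Type*} [Fintype m] [Fintype p] [DecidableEq p]
    (A : Matrix m p ℤ) (w : m → ℤ) (μ : p → ℝ) (B : ℤ)
    (hA : ∀ i j, |A i j| ≤ B) (hw : ∀ i, |w i| ≤ B)
    (hinj : Function.Injective (A.map ((↑) : ℤ → ℝ)).mulVec)
    (h : A.map ((↑) : ℤ → ℝ) *ᵥ μ = fun i => (w i : ℝ)) (j : p) :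
    |μ j| ≤ (Fintype.card p).factorial * (Fintype.card m * (B : ℝ) ^ 2) ^ Fintype.card p := by
  set Aℝ : Matrix m p ℝ := A.map ((↑) : ℤ → ℝ) with hAℝ
  -- The Gram matrix turns the rectangular system into a square integral one. Its determinant is a
  -- nonzero integer, so in Cramer's rule the numerator alone bounds the solution.
  have hdet : (Aᵀ * A).det ≠ 0 := by
    intro h0
    have hpos := (PosDef.conjTranspose_mul_self Aℝ hinj).det_pos
    have : (Aℝᴴ * Aℝ) = (Int.castRingHom ℝ).mapMatrix (Aᵀ * A) := by
      ext i j
      simp [Aℝ, Matrix.mul_apply]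
    rw [this, ← RingHom.map_det, h0] at hpos
    simp at hpos
  have hentry : ∀ u v : m → ℤ, (∀ i, |u i| ≤ B) → (∀ i, |v i| ≤ B) →
      |∑ i, u i * v i| ≤ Fintype.card m * B ^ 2 := by
    intro u v hu hv
    calc |∑ i, u i * v i| ≤ ∑ i, |u i * v i| := Finset.abs_sum_le_sum_abs _ _
      _ ≤ ∑ _i : m, B ^ 2 := Finset.sum_le_sum fun i _ => by
          rw [abs_mul, sq]
          exact mul_le_mul (hu i) (hv i) (abs_nonneg _) ((abs_nonneg _).trans (hu i))
      _ = _ := by simp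
  have hcr : ((Aᵀ * A).det : ℝ) * μ j = ((Aᵀ * A).cramer (Aᵀ *ᵥ w) j : ℤ) := by
    have h1 : (Int.castRingHom ℝ).mapMatrix (Aᵀ * A) *ᵥ μ =
        fun i => (((Aᵀ *ᵥ w) i : ℤ) : ℝ) := by
      have : (Int.castRingHom ℝ).mapMatrix (Aᵀ * A) = Aℝᵀ * Aℝ := by
        ext i j
        simp [Aℝ, Matrix.mul_apply]
      rw [this, ← Matrix.mulVec_mulVec, h]
      ext i
      simp [Aℝ, Matrix.mulVec, dotProduct]
    have h2 := congrFun (congrArg (((Int.castRingHom ℝ).mapMatrix (Aᵀ * A)).adjugate *ᵥ ·) h1) j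
    simp only [mulVec_mulVec] at h2
    rw [adjugate_mul, smul_mulVec, one_mulVec, Pi.smul_apply, smul_eq_mul, ← RingHom.map_det,
      ← RingHom.map_adjugate] at h2
    rw [cramer_eq_adjugate_mulVec]
    exact h2.trans (RingHom.map_mulVec (Int.castRingHom ℝ) _ _ j).symm
  have hcb : |(Aᵀ * A).cramer (Aᵀ *ᵥ w) j| ≤
      (Fintype.card p).factorial * (Fintype.card m * B ^ 2) ^ Fintype.card p := by
    rw [cramer_apply, ← nsmul_eq_mul]
    refine Matrix.det_le (abv := AbsoluteValue.abs) fun i i' => ?_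
    rw [AbsoluteValue.abs_apply, updateCol_apply]
    split_ifs
    · exact hentry (fun k => A k i) w (fun k => hA k i) hw
    · exact hentry (fun k => A k i) (fun k => A k i') (fun k => hA k i) fun k => hA k i'
  have hone : (1 : ℝ) ≤ |((Aᵀ * A).det : ℝ)| := by
    exact_mod_cast Int.one_le_abs hdet
  calc |μ j| ≤ |((Aᵀ * A).det : ℝ)| * |μ j| := le_mul_of_one_le_left (abs_nonneg _) hone
    _ = |(((Aᵀ * A).cramer (Aᵀ *ᵥ w) j : ℤ) : ℝ)| := by rw [← abs_mul, hcr]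
    _ ≤ _ := by exact_mod_cast hcb

theorem Rat.den_le_two_pow_ratSize (q : ℚ) : q.den ≤ 2 ^ ratSize q :=
  (Nat.lt_size_self _).le.trans (Nat.pow_le_pow_right two_pos (by unfold ratSize; omega))

theorem Rat.natAbs_num_le_two_pow_ratSize (q : ℚ) : q.num.natAbs ≤ 2 ^ ratSize q :=
  (Nat.lt_size_self _).le.trans (Nat.pow_le_pow_right two_pos (by unfold ratSize; omega))

theorem ratSize_le_vecSize {n : ℕ} (v : Fin n → ℚ) (i : Fin n) : ratSize (v i) ≤ vecSize v :=
  (Finset.single_le_sum (f := fun i => ratSize (v i)) (fun _ _ => Nat.zero_le _)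
    (Finset.mem_univ i)).trans (Nat.le_add_left _ _)

theorem ratSize_le_matSize {m n : ℕ} (A : Matrix (Fin m) (Fin n) ℚ) (i : Fin m) (j : Fin n) :
    ratSize (A i j) ≤ matSize A :=
  calc ratSize (A i j) ≤ ∑ j, ratSize (A i j) :=
        Finset.single_le_sum (f := fun j => ratSize (A i j)) (fun _ _ => Nat.zero_le _)
          (Finset.mem_univ j)
    _ ≤ ∑ i, ∑ j, ratSize (A i j) :=
        Finset.single_le_sum (f := fun i => ∑ j, ratSize (A i j)) (fun _ _ => Nat.zero_le _)
          (Finset.mem_univ i)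
    _ ≤ matSize A := Nat.le_add_left _ _

theorem prod_den_le_two_pow_vecSize {n : ℕ} (v : Fin n → ℚ) :
    ∏ i, (v i).den ≤ 2 ^ vecSize v :=
  calc ∏ i, (v i).den ≤ ∏ i, 2 ^ ratSize (v i) :=
        Finset.prod_le_prod' fun i _ => (v i).den_le_two_pow_ratSize
    _ = 2 ^ ∑ i, ratSize (v i) := Finset.prod_pow_eq_pow_sum _ _ _
    _ ≤ 2 ^ vecSize v := Nat.pow_le_pow_right two_pos (Nat.le_add_left _ _)

theorem prod_den_le_two_pow_matSize {m n : ℕ} (A : Matrix (Fin m) (Fin n) ℚ) :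
    ∏ i, ∏ j, (A i j).den ≤ 2 ^ matSize A :=
  calc ∏ i, ∏ j, (A i j).den ≤ ∏ i, ∏ j, 2 ^ ratSize (A i j) :=
        Finset.prod_le_prod' fun i _ => Finset.prod_le_prod' fun j _ =>
          (A i j).den_le_two_pow_ratSize
    _ = 2 ^ ∑ i, ∑ j, ratSize (A i j) := by simp only [Finset.prod_pow_eq_pow_sum]
    _ ≤ 2 ^ matSize A := Nat.pow_le_pow_right two_pos (Nat.le_add_left _ _)

/-- Clearing denominators keeps a rational number of bounded size bounded. -/
theorem exists_int_eq_mul_of_den_dvd {q : ℚ} {N L : ℕ} (hdvd : q.den ∣ N) (hN : N ≤ 2 ^ L)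
    (hq : ratSize q ≤ L) : ∃ z : ℤ, (z : ℝ) = N * (q : ℝ) ∧ |z| ≤ 2 ^ (2 * L) := by
  obtain ⟨e, rfl⟩ := hdvd
  refine ⟨e * q.num, ?_, ?_⟩
  · have : ((q.den : ℚ) : ℝ) * (q : ℝ) = q.num := by
      rw [← Rat.cast_mul, Rat.den_mul_eq_num, Rat.cast_intCast]
    rw [Rat.cast_natCast] at this
    push_cast
    linear_combination -(e : ℝ) * this
  · have he : e ≤ 2 ^ L := (Nat.le_mul_of_pos_left e q.den_pos).trans hN
    have hnum : q.num.natAbs ≤ 2 ^ L :=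
      q.natAbs_num_le_two_pow_ratSize.trans (Nat.pow_le_pow_right two_pos hq)
    have := Nat.mul_le_mul he hnum
    rw [abs_mul, Nat.abs_cast, Int.abs_eq_natAbs, two_mul, pow_add]
    exact_mod_cast this

/-- Source of the exponent 6L²: each of the p ≤ L factors is at most 2^(L + L + 4L). -/
theorem factorial_mul_pow_le {n p L : ℕ} (hn : n ≤ L) (hp : p ≤ L) :
    p.factorial * (n * (2 ^ (2 * L)) ^ 2) ^ p ≤ 2 ^ (6 * L ^ 2) :=
  calc p.factorial * (n * (2 ^ (2 * L)) ^ 2) ^ p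
      ≤ p ^ p * (n * (2 ^ (2 * L)) ^ 2) ^ p := Nat.mul_le_mul_right _ (Nat.factorial_le_pow p)
    _ = (p * (n * (2 ^ (2 * L)) ^ 2)) ^ p := (mul_pow _ _ _).symm
    _ ≤ (2 ^ L * (2 ^ L * (2 ^ (2 * L)) ^ 2)) ^ p := by
        have hL := (Nat.lt_two_pow_self (n := L)).le
        have h₁ := hn.trans hL
        have h₂ := hp.trans hL
        gcongr
    _ = 2 ^ (6 * L * p) := by
        simp only [← pow_mul, ← pow_add]
        congr 1
        ring
    _ ≤ 2 ^ (6 * L ^ 2) := by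
        refine Nat.pow_le_pow_right two_pos ?_
        nlinarith

/-! ### Multiplier bound and error bound for the follower -/

namespace BilevelData

variable {nx ny k l : ℕ}

/-- The rows of the system `D y ≥ r, -fᵀ y ≥ s` that describes the follower's optimal set. -/
def optRow (P : BilevelData nx ny k l) : Option (Fin l) → Fin ny → ℝ
  | none => -realVec P.f
  | some i => realMat P.D i

/-- A common denominator of the data `D`, `f` and `d`. -/
def commonDen (P : BilevelData nx ny k l) : ℕ :=
  (∏ i, ∏ j, (P.D i j).den) * (∏ j, (P.f j).den) * ∏ j, (P.d j).den

theorem commonDen_pos (P : BilevelData nx ny k l) : 0 < P.commonDen := by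
  refine Nat.mul_pos (Nat.mul_pos ?_ ?_) ?_
  · exact Finset.prod_pos fun i _ => Finset.prod_pos fun j _ => (P.D i j).den_pos
  · exact Finset.prod_pos fun j _ => (P.f j).den_pos
  · exact Finset.prod_pos fun j _ => (P.d j).den_pos

theorem commonDen_le (P : BilevelData nx ny k l) : P.commonDen ≤ 2 ^ P.encodingLength :=
  calc P.commonDen ≤ 2 ^ matSize P.D * 2 ^ vecSize P.f * 2 ^ vecSize P.d :=
        Nat.mul_le_mul (Nat.mul_le_mul (prod_den_le_two_pow_matSize _)
          (prod_den_le_two_pow_vecSize _)) (prod_den_le_two_pow_vecSize _)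
    _ = 2 ^ (matSize P.D + vecSize P.f + vecSize P.d) := by rw [pow_add, pow_add]
    _ ≤ 2 ^ P.encodingLength :=
        Nat.pow_le_pow_right two_pos (by unfold encodingLength; omega)

theorem exists_int_optRow (P : BilevelData nx ny k l) (o : Option (Fin l)) (j : Fin ny) :
    ∃ z : ℤ, (z : ℝ) = P.commonDen * P.optRow o j ∧ |z| ≤ 2 ^ (2 * P.encodingLength) := by
  cases o with
  | none =>
    obtain ⟨z, hz, hb⟩ := exists_int_eq_mul_of_den_dvd (q := P.f j) (N := P.commonDen)
      (((Finset.dvd_prod_of_mem (fun j => (P.f j).den) (Finset.mem_univ j)).mul_left _).mul_right _)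
      P.commonDen_le ((ratSize_le_vecSize P.f j).trans (by unfold encodingLength; omega))
    refine ⟨-z, ?_, by rwa [abs_neg]⟩
    simp [optRow, realVec, hz]
  | some i =>
    exact exists_int_eq_mul_of_den_dvd
      ((((Finset.dvd_prod_of_mem (fun j => (P.D i j).den) (Finset.mem_univ j)).trans
        (Finset.dvd_prod_of_mem (fun i => ∏ j, (P.D i j).den) (Finset.mem_univ i))).mul_right
          _).mul_right _)
      P.commonDen_le ((ratSize_le_matSize P.D i j).trans (by unfold encodingLength; omega))

theorem exists_int_d (P : BilevelData nx ny k l) (j : Fin ny) :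
    ∃ z : ℤ, (z : ℝ) = P.commonDen * realVec P.d j ∧ |z| ≤ 2 ^ (2 * P.encodingLength) :=
  exists_int_eq_mul_of_den_dvd
    ((Finset.dvd_prod_of_mem (fun j => (P.d j).den) (Finset.mem_univ j)).mul_left _)
    P.commonDen_le ((ratSize_le_vecSize P.d j).trans (by unfold encodingLength; omega))

/-- Basic multipliers have polynomially many bits. -/
theorem basic_multiplier_le (P : BilevelData nx ny k l) (t : Finset (Option (Fin l)))
    (μ : Option (Fin l) → ℝ) (hli : LinearIndepOn ℝ P.optRow (t : Set (Option (Fin l))))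
    (hd : ∑ o ∈ t, μ o • P.optRow o = realVec P.d) (o : Option (Fin l)) (ho : o ∈ t) :
    μ o ≤ 2 ^ (6 * P.encodingLength ^ 2) := by
  choose A hA hAb using fun (j : Fin ny) (o : t) => P.exists_int_optRow o j
  choose w hw hwb using P.exists_int_d
  let R : Matrix (Fin ny) t ℝ := of fun j o => P.optRow o j
  have hAR : (of A).map ((↑) : ℤ → ℝ) = (P.commonDen : ℝ) • R := by
    ext j o
    simp [R, hA]
  have hN : (P.commonDen : ℝ) ≠ 0 := by exact_mod_cast P.commonDen_pos.ne'
  have hRinj : Function.Injective R.mulVec := mulVec_injective_iff.2 hli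
  have hinj : Function.Injective ((of A).map ((↑) : ℤ → ℝ)).mulVec := by
    intro u v huv
    simp only [hAR, smul_mulVec] at huv
    exact hRinj (smul_right_injective _ hN huv)
  have hRμ : R *ᵥ (fun o : t => μ o) = realVec P.d := by
    ext j
    rw [← hd, Finset.sum_apply, ← Finset.sum_coe_sort]
    simp [R, mulVec, dotProduct, mul_comm]
  have hsys : (of A).map ((↑) : ℤ → ℝ) *ᵥ (fun o : t => μ o) = fun j => (w j : ℝ) := by
    ext j
    rw [hAR, smul_mulVec, hRμ, hw, Pi.smul_apply, smul_eq_mul]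
  have hny : ny ≤ P.encodingLength := by
    unfold encodingLength vecSize
    omega
  have hcard : Fintype.card t ≤ ny := by
    simpa using LinearIndependent.fintype_card_le_finrank hli
  have hb := abs_le_of_integral_system (of A) w (fun o : t => μ o) (2 ^ (2 * P.encodingLength))
    hAb hwb hinj hsys ⟨o, ho⟩
  refine (le_abs_self _).trans (hb.trans ?_)
  have := factorial_mul_pow_le hny (hcard.trans hny)
  rw [Fintype.card_fin]
  exact_mod_cast this

theorem mem_followerFeasible_iff (P : BilevelData nx ny k l) (x : Fin nx → ℝ) (y : Fin ny → ℝ) :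
    y ∈ P.followerFeasible x ↔
      ∀ i, realVec P.b i - (realMat P.C *ᵥ x) i ≤ P.optRow (some i) ⬝ᵥ y := by
  refine forall_congr' fun i => ?_
  rw [sub_le_iff_le_add']
  rfl

/-- Error bound for the follower's problem: from a feasible point one reaches an optimal one at a
cost in `dᵀ y` that is at most `2 ^ (6 L ^ 2)` times the optimality gap. -/
theorem exists_mem_followerOpt_dotProduct_le (P : BilevelData nx ny k l) (x : Fin nx → ℝ)
    (hcomp : IsCompact (P.followerFeasible x)) (ybar : Fin ny → ℝ)
    (hybar : ybar ∈ P.followerFeasible x) :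
    ∃ y ∈ P.followerOpt x, realVec P.d ⬝ᵥ y ≤ realVec P.d ⬝ᵥ ybar +
      2 ^ (6 * P.encodingLength ^ 2) * (realVec P.f ⬝ᵥ ybar - realVec P.f ⬝ᵥ y) := by
  have hcont : ∀ v : Fin ny → ℝ, Continuous fun y : Fin ny → ℝ => v ⬝ᵥ y := fun v => by
    unfold dotProduct
    fun_prop
  obtain ⟨y₀, hy₀, hmin₀⟩ := hcomp.exists_isMinOn ⟨ybar, hybar⟩ (hcont (realVec P.f)).continuousOn
  rw [isMinOn_iff] at hmin₀
  have hopt : ∀ y, y ∈ P.followerOpt x ↔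
      y ∈ P.followerFeasible x ∧ realVec P.f ⬝ᵥ y ≤ realVec P.f ⬝ᵥ y₀ := fun y =>
    ⟨fun h => ⟨h.1, isMinOn_iff.1 h.2 y₀ hy₀⟩,
      fun h => ⟨h.1, isMinOn_iff.2 fun z hz => h.2.trans (hmin₀ z hz)⟩⟩
  have hScomp : IsCompact (P.followerOpt x) := by
    have : P.followerOpt x = P.followerFeasible x ∩ {y | realVec P.f ⬝ᵥ y ≤ realVec P.f ⬝ᵥ y₀} :=
      Set.ext hopt
    rw [this]
    exact hcomp.inter_right (isClosed_le (hcont _) continuous_const)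
  obtain ⟨y, hy, hmin⟩ := hScomp.exists_isMinOn ⟨y₀, (hopt y₀).2 ⟨hy₀, le_rfl⟩⟩
    (hcont (realVec P.d)).continuousOn
  rw [isMinOn_iff] at hmin
  -- The `none` row encodes that fᵀz is at most the optimal value fᵀy₀.
  let r : Option (Fin l) → ℝ := fun o =>
    o.elim (-(realVec P.f ⬝ᵥ y₀)) fun i => realVec P.b i - (realMat P.C *ᵥ x) i
  have hsys : ∀ z, (∀ o, r o ≤ P.optRow o ⬝ᵥ z) ↔ z ∈ P.followerOpt x := by
    intro z
    rw [hopt, mem_followerFeasible_iff, Option.forall, and_comm]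
    simp [r, optRow]
  obtain ⟨t, μ, hμ, hact, hli, hd⟩ := exists_basic_multipliers P.optRow r (realVec P.d) y
    ((hsys y).2 hy) fun z hz => hmin z ((hsys z).1 hz)
  refine ⟨y, hy, ?_⟩
  have hfy : realVec P.f ⬝ᵥ y = realVec P.f ⬝ᵥ y₀ :=
    le_antisymm ((hopt y).1 hy).2 (hmin₀ y hy.1)
  have hgap : 0 ≤ realVec P.f ⬝ᵥ ybar - realVec P.f ⬝ᵥ y :=
    sub_nonneg.2 (isMinOn_iff.1 hy.2 ybar hybar)
  set ε := realVec P.f ⬝ᵥ ybar - realVec P.f ⬝ᵥ y with hε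
  -- Rows in `t` are active at `y`, so the difference in dᵀ is the multiplier-weighted sum of the
  -- slacks of `ybar`.
  have hdiff : realVec P.d ⬝ᵥ ybar - realVec P.d ⬝ᵥ y =
      ∑ o ∈ t, μ o * (P.optRow o ⬝ᵥ ybar - r o) := by
    rw [← hd, sum_dotProduct, sum_dotProduct, ← Finset.sum_sub_distrib]
    refine Finset.sum_congr rfl fun o ho => ?_
    rw [smul_dotProduct, smul_dotProduct, hact o ho, smul_eq_mul, smul_eq_mul, mul_sub]
  -- Only the optimality row can contribute negatively; the indicator also covers the case where it
  -- is not in `t`.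
  have hterm : ∀ o ∈ t, (if o = none then -(2 ^ (6 * P.encodingLength ^ 2) * ε) else 0) ≤
      μ o * (P.optRow o ⬝ᵥ ybar - r o) := by
    intro o ho
    cases o with
    | none =>
      have h₁ : P.optRow none ⬝ᵥ ybar - r none = -ε := by
        simp only [optRow, r, neg_dotProduct, Option.elim_none, hε, hfy]
        ring
      rw [if_pos rfl, h₁, mul_neg, neg_le_neg_iff]
      exact mul_le_mul_of_nonneg_right (P.basic_multiplier_le t μ hli hd _ ho) hgap
    | some i =>
      rw [if_neg (by simp)]
      exact mul_nonneg (hμ _ ho)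
        (sub_nonneg.2 ((P.mem_followerFeasible_iff x ybar).1 hybar i))
  have hsum := Finset.sum_le_sum hterm
  rw [← hdiff, Finset.sum_ite_eq'] at hsum
  have hK : 0 ≤ 2 ^ (6 * P.encodingLength ^ 2) * ε := by positivity
  split_ifs at hsum <;> linarith

/-! ### Comparing the coupled and penalized objectives -/

theorem coupledObj_le_of_mem_followerOpt (P : BilevelData nx ny k l) {x : Fin nx → ℝ}
    {y : Fin ny → ℝ} (hy : y ∈ P.followerOpt x) :
    P.coupledObj (x, y) ≤ ((realVec P.c ⬝ᵥ x + realVec P.d ⬝ᵥ y : ℝ) : EReal) := by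
  have hz : ((y, 0) : (Fin ny → ℝ) × ℝ) ∈
      {z : (Fin ny → ℝ) × ℝ | z.2 = 0 ∧ z ∈ P.auxFollowerOpt (x, y)} :=
    ⟨rfl, ⟨hy.1, sub_self _, le_rfl⟩,
      isMinOn_iff.2 fun z hz => isMinOn_iff.1 hy.2 z.1 hz.1⟩
  calc P.coupledObj (x, y)
      ≤ ((realVec P.c ⬝ᵥ x + realVec P.d ⬝ᵥ y : ℝ) : EReal) + 0 :=
        add_le_add_right (iInf₂_le _ hz) _
    _ = _ := add_zero _

theorem penalizedObj_le_coupledObj (P : BilevelData nx ny k l) (κ : ℝ)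
    (p : (Fin nx → ℝ) × (Fin ny → ℝ)) : P.penalizedObj κ p ≤ P.coupledObj p := by
  refine add_le_add_right (le_iInf₂ fun z hz => (iInf₂_le z hz.2).trans ?_) _
  rw [hz.1, mul_zero, EReal.coe_zero]

/-- The follower's `ε` is at least the optimality gap of `ȳ`. -/
theorem le_penalizedObj (P : BilevelData nx ny k l) {κ : ℝ} (hκ : 0 ≤ κ) {x : Fin nx → ℝ}
    {y ybar : Fin ny → ℝ} (hy : y ∈ P.followerOpt x) (hybar : ybar ∈ P.followerFeasible x) :
    ((realVec P.c ⬝ᵥ x + realVec P.d ⬝ᵥ ybar +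
      κ * (realVec P.f ⬝ᵥ ybar - realVec P.f ⬝ᵥ y) : ℝ) : EReal) ≤ P.penalizedObj κ (x, ybar) := by
  rw [EReal.coe_add]
  refine add_le_add_right (le_iInf₂ fun z hz => EReal.coe_le_coe_iff.2 ?_) _
  -- The follower's optimum `y`, paired with the gap of `ybar`, is a feasible competitor.
  have hle : realVec P.f ⬝ᵥ z.1 ≤ realVec P.f ⬝ᵥ y :=
    isMinOn_iff.1 hz.2 (y, realVec P.f ⬝ᵥ ybar - realVec P.f ⬝ᵥ y)
      ⟨hy.1, rfl, sub_nonneg.2 (isMinOn_iff.1 hy.2 ybar hybar)⟩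
  have hz2 : realVec P.f ⬝ᵥ ybar - realVec P.f ⬝ᵥ z.1 = z.2 := hz.1.2.1
  exact mul_le_mul_of_nonneg_left (by linarith) hκ

end BilevelData

/-! ### Exact penalization and choice of κ -/

/-- Exact penalization: a relaxation `H` of `F` has the same minimizers if wherever the two differ
some value of `F` lies strictly below that of `H`. -/
theorem globalOptimizers_eq_of_exact_penalty {α : Type*} {K : Set α} {F H : α → EReal}
    (hle : ∀ p, H p ≤ F p) (hex : ∀ p ∈ K, F p = H p ∨ ∃ q ∈ K, F q < H p) :
    globalOptimizers K F = globalOptimizers K H := by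
  ext p
  simp only [globalOptimizers, Set.mem_ofPred_eq, isMinOn_iff]
  refine ⟨fun ⟨hp, hfin, hmin⟩ => ⟨hp, (hle p).trans_lt hfin, fun q hq => (hle p).trans ?_⟩,
    fun ⟨hp, hfin, hmin⟩ => ?_⟩
  · rcases hex q hq with h | ⟨q', hq', h⟩
    · exact h ▸ hmin q hq
    · exact (hmin q' hq').trans h.le
  · rcases hex p hp with h | ⟨q, hq, h⟩
    · exact ⟨hp, h ▸ hfin, fun q hq => h ▸ (hmin q hq).trans (hle q)⟩
    · exact absurd ((hmin q hq).trans (hle q)) h.not_ge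

theorem mainTheorem3 :
    ∃ q : Polynomial ℕ, ∀ (nx ny k l : ℕ) (P : BilevelData nx ny k l),
      P.StandingAssumptions →
        ∃ κ : ℚ, 0 < κ ∧ ratSize κ ≤ q.eval P.encodingLength ∧
          globalOptimizers P.auxLeaderSet P.coupledObj =
            globalOptimizers P.auxLeaderSet (P.penalizedObj (κ : ℝ)) := by
  refine ⟨6 * Polynomial.X ^ 2 + 4, fun nx ny k l P hP => ?_⟩
  -- The extra factor 2 over the multiplier bound makes the penalty win strictly. With m = 6L² + 1,
  -- the size of 2^m is 1 + (m + 1) + 1 = 6L² + 4.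
  refine ⟨((2 ^ (6 * P.encodingLength ^ 2 + 1) : ℕ) : ℚ), by positivity, ?_, ?_⟩
  · simp only [ratSize, Rat.num_natCast, Rat.den_natCast, Int.natAbs_natCast, Nat.size_pow,
      Nat.size_one, Polynomial.eval_add, Polynomial.eval_mul, Polynomial.eval_pow,
      Polynomial.eval_X, Polynomial.eval_ofNat]
    omega
  · refine globalOptimizers_eq_of_exact_penalty (P.penalizedObj_le_coupledObj _) ?_
    rintro ⟨x, ybar⟩ ⟨hx, hfeas⟩
    have hybar : ybar ∈ P.followerFeasible x := sub_le_iff_le_add'.1 hfeas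
    obtain ⟨y, hy, hle⟩ :=
      P.exists_mem_followerOpt_dotProduct_le x (hP.follower_compact x hx) ybar hybar
    have hpen := P.le_penalizedObj
      (κ := (((2 ^ (6 * P.encodingLength ^ 2 + 1) : ℕ) : ℚ) : ℝ)) (by positivity) hy hybar
    rcases (sub_nonneg.2 (isMinOn_iff.1 hy.2 ybar hybar)).eq_or_lt with hgap | hgap
    · left
      refine le_antisymm ?_ (P.penalizedObj_le_coupledObj _ _)
      have hopt : ybar ∈ P.followerOpt x :=
        ⟨hybar, isMinOn_iff.2 fun z hz =>
          (sub_nonpos.1 hgap.ge).trans (isMinOn_iff.1 hy.2 z hz)⟩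
      rw [← hgap, mul_zero, add_zero] at hpen
      exact (P.coupledObj_le_of_mem_followerOpt hopt).trans hpen
    · right
      refine ⟨(x, y), ⟨hx, sub_le_iff_le_add'.2 hy.1⟩,
        (P.coupledObj_le_of_mem_followerOpt hy).trans_lt (lt_of_lt_of_le ?_ hpen)⟩
      rw [EReal.coe_lt_coe_iff]
      push_cast
      have : 0 < (2 : ℝ) ^ (6 * P.encodingLength ^ 2) *
          (realVec P.f ⬝ᵥ ybar - realVec P.f ⬝ᵥ y) := mul_pos (by positivity) hgap
      rw [pow_succ]
      linarith
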